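/- Let $\mathcal F$ be the family of nonempty finite subsets of $\mathbb N=\{1,2,\dots\}$, and for $\alpha,\beta\in\mathcal F$ write $\alpha<\beta$ if $\max\alpha<\min\beta$. An IP-ring is a family $\mathcal F^{(1)}=\{\bigcup_{i\in\beta}\alpha_i:\beta\in\mathcal F\}$, where $\alpha_1<\alpha_2<\cdots$ is a sequence in $\mathcal F$. Let $(n_i)_{i\ge1}$ be a sequence of integers and, for $\alpha\in\mathcal F$, put $n_\alpha=\sum_{i\in\alpha}n_i$, so that $A=\{n_\alpha\}_{\alpha\in\mathcal F}$ is the IP-set generated by $(n_i)$. Let $X$ be a compact metric space and let $\Gamma$ be an abelian Hausdorff topological group acting continuously on $X$. Assume that every $T\in\Gamma$ with $T\ne e_\Gamma$ - is minimal, i.e. for every $x\in X$ the orbit $\{T^m x:m\in\mathbb Z\}$ is dense in $X$, and - is mixing along $\{n_\alpha\}_{\alpha\in\mathcal F}$, i.e. for all nonempty open $U,V\subseteq X$ and every IP-ring $\mathcal F^{(1)}$ there is $\alpha\in\mathcal F^{(1)}$ with $U\cap T^{-n_\alpha}V\neq\emptyset$. Let $d,k\ge1$, let $T_1,\dots,T_d\in\Gamma$,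 let $p_{i,j}$ ($1\le i\le k$, $1\le j\le d$) be integral polynomials (polynomials taking integer values at the integers), and put $$g_i(n)=T_1^{p_{i,1}(n)}\cdots T_d^{p_{i,d}(n)}\in\Gamma,\qquad n\in\mathbb Z,\ 1\le i\le k.$$ Assume that each $g_i(n)$, and each $g_i(n)g_j(n)^{-1}$ with $i\ne j$, depends nontrivially on $n$, i.e. is not constant as a function $\mathbb Z\to\Gamma$. Then for every IP-ring $\mathcal F^{(1)}$ there is a dense $G_\delta$ set $X_0\subseteq X$ such that for every $x\in X_0$ the set $$\{(g_1(n_\alpha)x,\dots,g_k(n_\alpha)x):\alpha\in\mathcal F^{(1)}\}$$ is dense in $X^k$. -/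

import Mathlib

namespace IPSystem

/-- `α < β` for finite sets of indices: every element of `α` is below every element of `β`
(for nonempty sets, `max α < min β`). -/
def Before (α β : Finset ℕ) : Prop :=
  ∀ a ∈ α, ∀ b ∈ β, a < b

/-- An IP-ring: the family of all finite unions `⋃_{i ∈ β} a i`, with `β` nonempty and finite, of a
sequence of nonempty finite index sets `a 0 < a 1 < a 2 < ⋯`. -/
def IsIPRing (R : Set (Finset ℕ)) : Prop :=
  ∃ a : ℕ → Finset ℕ, (∀ i, (a i).Nonempty) ∧ (∀ i, Before (a i) (a (i + 1))) ∧
    R = {α | ∃ β : Finset ℕ, β.Nonempty ∧ α = β.biUnion a}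

/-- The element `n_α = ∑_{i ∈ α} n_i` of the IP-set in `ℤ` generated by the sequence `n`. -/
def ipSum (n : ℕ → ℤ) (α : Finset ℕ) : ℤ :=
  ∑ i ∈ α, n i

/-- An integral polynomial, viewed as a function on `ℤ`: a polynomial that takes integer values at
the integers (its coefficients are then rational). -/
def IsIntegralPolynomial (p : ℤ → ℤ) : Prop :=
  ∃ q : Polynomial ℚ, ∀ m : ℤ, q.eval (m : ℚ) = (p m : ℚ)

/-- `(X, T)` is mixing along the IP-set generated by `n`: for all nonempty open `U`, `V` and every
IP-ring `R` there is `α ∈ R` with `U ∩ T^{-n_α} V ≠ ∅`. -/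
def IsMixingAlong (X : Type*) [TopologicalSpace X] {Γ : Type*} [Group Γ] [MulAction Γ X]
    (n : ℕ → ℤ) (T : Γ) : Prop :=
  ∀ U V : Set X, IsOpen U → IsOpen V → U.Nonempty → V.Nonempty →
    ∀ R : Set (Finset ℕ), IsIPRing R →
      ∃ α ∈ R, (U ∩ {x | T ^ ipSum n α • x ∈ V}).Nonempty

/-- The expression `T_1^{p_1(m)} ⋯ T_d^{p_d(m)}`. -/
def polyExpr {Γ : Type*} [CommGroup Γ] {d : ℕ} (T : Fin d → Γ) (p : Fin d → ℤ → ℤ) (m : ℤ) : Γ :=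
  ∏ j, T j ^ p j m

/-- The `Γ`-valued expression `g` depends nontrivially on its argument: it is not constant. -/
def DependsNontrivially {Γ : Type*} (g : ℤ → Γ) : Prop :=
  ¬ ∃ c : Γ, ∀ m : ℤ, g m = c

end IPSystem

namespace IPSystem

open Hindman

/-! ### IP-rings and Hindman's theorem -/

/-! By Baire it suffices that, for nonempty open `U`, `V i`, some `α ∈ R` and `x ∈ U` satisfy `g i
(n_α) • x ∈ V i` for all `i`: the points whose orbit tuples meet a given basic open set of `X^k`
then form a dense open set.

If `X` has two points, mixing makes `Γ` torsion-free, because every IP-ring contains a subring on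
which `q ∣ n_α`. The group generated by the `T j` is then free abelian and embeds additively in
`ℚ[X]`. The `g i`, divided by their values at `0`, become distinct nonzero polynomials over this
domain; the polynomial `0` is added with target `U`.

The core, `exists_forall_smul_mem`, is a PET induction. By minimality and compactness, finitely many
`t ∈ F` move every point into `V 0`. Each `t` gets its own shift `m t`, and a shift of a
minimal-degree polynomial `h` is subtracted from all shifted polynomials, which lowers the weight.
The inductive point is moved back by that shift of `h` and then by a suitable `t`. Shifts in degree
at least two are chosen distinct, so each has its own target; linear polynomials do not change under
shifts, so mixing supplies one target good for all `t`. Hindman's theorem lets these choices be made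
simultaneously. -/

theorem Before.disjoint {α β : Finset ℕ} (h : Before α β) : Disjoint α β :=
  Finset.disjoint_left.2 fun a ha hb => lt_irrefl _ (h a ha a hb)

theorem before_of_lt {a : ℕ → Finset ℕ} (hne : ∀ i, (a i).Nonempty)
    (ha : ∀ i, Before (a i) (a (i + 1))) {i j : ℕ} (hij : i < j) : Before (a i) (a j) := by
  induction j, hij using Nat.le_induction with
  | base => exact ha i
  | succ j _ ih =>
    obtain ⟨c, hc⟩ := hne j
    exact fun x hx y hy => (ih x hx c hc).trans (ha j c hc y hy)

theorem before_union_iff_left {α β γ : Finset ℕ} :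
    Before (α ∪ β) γ ↔ Before α γ ∧ Before β γ := by
  simp only [Before, Finset.mem_union, or_imp, forall_and]

theorem before_union_iff_right {α β γ : Finset ℕ} :
    Before α (β ∪ γ) ↔ Before α β ∧ Before α γ := by
  simp only [Before, Finset.mem_union, or_imp, forall_and]

/-- Finite sets of naturals with the union of consecutive sets as a product; all other products
are an absorbing element. -/
inductive OrderedUnion : Type
  | set (α : Finset ℕ) : OrderedUnion
  | undefined : OrderedUnion

namespace OrderedUnion

open Classical in
/-- The product on `OrderedUnion`. -/
noncomputable def mul : OrderedUnion → OrderedUnion → OrderedUnion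
  | set α, set β => if Before α β then set (α ∪ β) else undefined
  | set _, undefined => undefined
  | undefined, _ => undefined

theorem mul_set {α β : Finset ℕ} (h : Before α β) : mul (set α) (set β) = set (α ∪ β) :=
  if_pos h

theorem mul_set_of_not {α β : Finset ℕ} (h : ¬ Before α β) : mul (set α) (set β) = undefined :=
  if_neg h

theorem mul_undefined (x : OrderedUnion) : mul x undefined = undefined := by
  cases x <;> rfl

theorem undefined_mul (x : OrderedUnion) : mul undefined x = undefined := rfl

theorem before_of_mul_eq_set {α β γ : Finset ℕ} (h : mul (set α) (set β) = set γ) :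
    Before α β := by
  by_contra hn
  rw [mul_set_of_not hn] at h
  exact OrderedUnion.noConfusion h

/-- Either bracketing is defined exactly when all three pairs are ordered. The relation between `x`
and `z` has to be tested separately, since `y` may be empty. -/
theorem mul_assoc' (x y z : OrderedUnion) : mul (mul x y) z = mul x (mul y z) := by
  cases x with
  | undefined => simp only [undefined_mul]
  | set x =>
    cases y with
    | undefined => simp only [undefined_mul, mul_undefined]
    | set y =>
      cases z with
      | undefined => simp only [mul_undefined]
      | set z =>
        by_cases h₁ : Before x y
        · rw [mul_set h₁]
          by_cases h₂ : Before y z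
          · rw [mul_set h₂]
            by_cases h₃ : Before x z
            · rw [mul_set (before_union_iff_left.2 ⟨h₃, h₂⟩),
                mul_set (before_union_iff_right.2 ⟨h₁, h₃⟩), Finset.union_assoc]
            · rw [mul_set_of_not fun h => h₃ (before_union_iff_left.1 h).1,
                mul_set_of_not fun h => h₃ (before_union_iff_right.1 h).2]
          · rw [mul_set_of_not h₂, mul_undefined,
              mul_set_of_not fun h => h₂ (before_union_iff_left.1 h).2]
        · rw [mul_set_of_not h₁, undefined_mul]
          by_cases h₂ : Before y z
          · rw [mul_set h₂, mul_set_of_not fun h => h₁ (before_union_iff_right.1 h).1]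
          · rw [mul_set_of_not h₂, mul_undefined]

noncomputable instance : Semigroup OrderedUnion where
  mul := mul
  mul_assoc := mul_assoc'

end OrderedUnion

/-- Peeling off the least index leaves a product from the tail of the stream; hence the induction
carries the starting position `n`. -/
theorem mem_FP_of_biUnion (b : Stream' OrderedUnion) (β : ℕ → Finset ℕ)
    (hb : ∀ i, b.get i = .set (β i))
    (hβ : ∀ i j, i < j → Before (β i) (β j)) (s : Finset ℕ) :
    s.Nonempty → ∀ n, (∀ x ∈ s, n ≤ x) →
      OrderedUnion.set (s.biUnion β) ∈ FP (b.drop n) := by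
  induction s using Finset.induction_on_min with
  | empty => simp
  | insert a s has ih =>
    intro _ n hn
    have hna : n ≤ a := hn a (Finset.mem_insert_self _ _)
    obtain ⟨e, rfl⟩ := Nat.exists_eq_add_of_le hna
    have hdrop : FP (b.drop (n + e)) ⊆ FP (b.drop n) := by
      have := FP_drop_subset_FP (b.drop n) e
      rwa [Stream'.drop_drop] at this
    apply hdrop
    have hhead : (b.drop (n + e)).head = .set (β (n + e)) := by
      rw [Stream'.head_drop, hb]
    rcases s.eq_empty_or_nonempty with rfl | hs
    · have := FP.head (b.drop (n + e))
      rw [hhead] at this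
      simpa using this
    · have h1 := ih hs (n + e + 1) (fun x hx => has x hx)
      have h2 : (b.drop (n + e)).tail = b.drop (n + e + 1) := by
        rw [Stream'.tail_eq_drop, Stream'.drop_drop]
      rw [← h2] at h1
      have h3 := FP.cons _ _ h1
      rw [hhead] at h3
      have h4 : Before (β (n + e)) (s.biUnion β) := by
        intro x hx y hy
        obtain ⟨i, hi, hy⟩ := Finset.mem_biUnion.1 hy
        exact hβ _ _ (has i hi) x hx y hy
      rw [Finset.biUnion_insert]
      exact (OrderedUnion.mul_set h4) ▸ h3

theorem exists_biUnion_of_mem_FP (a : ℕ → Finset ℕ) (hne : ∀ i, (a i).Nonempty)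
    (ha : ∀ i, Before (a i) (a (i + 1))) (c : Stream' OrderedUnion) (m : OrderedUnion)
    (hm : m ∈ FP c) : ∀ n, (∀ i, c.get i = .set (a (n + i))) →
      ∃ β : Finset ℕ, β.Nonempty ∧ (∀ x ∈ β, n ≤ x) ∧
        m = .set (β.biUnion a) := by
  induction hm with
  | head' c =>
    intro n hc
    exact ⟨{n}, by simp, by simp, by simpa using! hc 0⟩
  | tail' c m h ih =>
    intro n hc
    obtain ⟨β, h1, h2, h3⟩ := ih (n + 1) (fun i => by
      have := hc (i + 1)
      rw [show n + (i + 1) = n + 1 + i by ring] at this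
      exact this)
    exact ⟨β, h1, fun x hx => (Nat.le_succ n).trans (h2 x hx), h3⟩
  | cons' c m h ih =>
    intro n hc
    obtain ⟨β, h1, h2, h3⟩ := ih (n + 1) (fun i => by
      have := hc (i + 1)
      rw [show n + (i + 1) = n + 1 + i by ring] at this
      exact this)
    refine ⟨insert n β, by simp, ?_, ?_⟩
    · intro x hx
      rcases Finset.mem_insert.1 hx with rfl | hx
      · exact le_rfl
      · exact (Nat.le_succ n).trans (h2 x hx)
    · have h4 : c.head = .set (a n) := by simpa using! hc 0
      rw [h3, h4, Finset.biUnion_insert]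
      refine OrderedUnion.mul_set ?_
      intro x hx y hy
      obtain ⟨i, hi, hy⟩ := Finset.mem_biUnion.1 hy
      exact before_of_lt hne ha (h2 i hi) x hx y hy

/-- **Hindman's theorem** for IP-rings: a property with a witness in every IP-ring holds
throughout some subring of each IP-ring. -/
theorem IsIPRing.exists_subring {R : Set (Finset ℕ)} (hR : IsIPRing R) {Q : Finset ℕ → Prop}
    (hQ : ∀ R', IsIPRing R' → ∃ α ∈ R', Q α) :
    ∃ R', IsIPRing R' ∧ R' ⊆ R ∧ ∀ α ∈ R', Q α := by
  obtain ⟨a, hne, ha, rfl⟩ := hR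
  set R : Set (Finset ℕ) := {α | ∃ β : Finset ℕ, β.Nonempty ∧ α = β.biUnion a} with hRdef
  -- Every product in `FP b` is a genuine set, never `undefined`, so the terms of `b` are forced to
  -- be consecutive and generate an IP-ring.
  have key : ∀ (P : Finset ℕ → Prop) (b : Stream' OrderedUnion),
      FP b ⊆ {m | ∃ α : Finset ℕ, α ∈ R ∧ P α ∧ m = .set α} →
      ∃ R', IsIPRing R' ∧ R' ⊆ R ∧ ∀ α ∈ R', P α := by
    intro P b hb
    choose β hβR hβP hβ using fun i => hb (FP.singleton b i)
    have hbef : ∀ i j, i < j → Before (β i) (β j) := by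
      intro i j hij
      obtain ⟨γ, -, -, hγ⟩ := hb (FP.mul_two b i j hij)
      rw [hβ i, hβ j] at hγ
      exact OrderedUnion.before_of_mul_eq_set hγ
    have hmem : ∀ s : Finset ℕ, s.Nonempty → s.biUnion β ∈ R ∧ P (s.biUnion β) := by
      intro s hs
      obtain ⟨γ, h1, h2, h3⟩ := hb (mem_FP_of_biUnion b β hβ hbef s hs 0 (fun _ _ => Nat.zero_le _))
      obtain rfl := OrderedUnion.set.inj h3
      exact ⟨h1, h2⟩
    refine ⟨_, ⟨β, ?_, fun i => hbef _ _ (Nat.lt_succ_self i), rfl⟩, ?_, ?_⟩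
    · intro i
      obtain ⟨s, ⟨j, hj⟩, hs⟩ := hβR i
      obtain ⟨x, hx⟩ := hne j
      exact ⟨x, hs ▸ Finset.mem_biUnion.2 ⟨j, hj, hx⟩⟩
    · rintro _ ⟨s, hs, rfl⟩
      exact (hmem s hs).1
    · rintro _ ⟨s, hs, rfl⟩
      exact (hmem s hs).2
  let c : (Finset ℕ → Prop) → Set OrderedUnion := fun P =>
    {m | ∃ α : Finset ℕ, α ∈ R ∧ P α ∧ m = .set α}
  obtain ⟨d, hd, b, hb⟩ := FP_partition_regular
    (show Stream' OrderedUnion from fun i => .set (a i))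
    {c Q, c (fun α => ¬ Q α)} (by simp) (by
      intro m hm
      obtain ⟨β, h1, -, h3⟩ := exists_biUnion_of_mem_FP a hne ha _ m hm 0
        (fun i => by rw [zero_add]; rfl)
      by_cases h : Q (β.biUnion a)
      · exact ⟨c Q, by simp, _, ⟨β, h1, rfl⟩, h, h3⟩
      · exact ⟨c fun α => ¬ Q α, by simp, _, ⟨β, h1, rfl⟩, h, h3⟩)
  rcases hd with rfl | hd
  · exact key _ b hb
  -- The other colour would give a subring avoiding `Q`, against `hQ`.
  · rw [Set.mem_singleton_iff.1 hd] at hb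
    obtain ⟨R', h1, -, h3⟩ := key _ b hb
    obtain ⟨α, hα, hαQ⟩ := hQ R' h1
    exact absurd hαQ (h3 α hα)

/-- A property of finite sets with a witness in every IP-ring. -/
def IsIPStar (Q : Finset ℕ → Prop) : Prop :=
  ∀ R, IsIPRing R → ∃ α ∈ R, Q α

theorem IsIPStar.and {P Q : Finset ℕ → Prop} (hP : IsIPStar P) (hQ : IsIPStar Q) :
    IsIPStar fun α => P α ∧ Q α := by
  intro R hR
  obtain ⟨R', h1, h2, h3⟩ := hR.exists_subring hP
  obtain ⟨α, h4, h5⟩ := hQ R' h1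
  exact ⟨α, h2 h4, h3 α h4, h5⟩

theorem isIPStar_true : IsIPStar fun _ => True := by
  rintro _ ⟨a, -, -, rfl⟩
  exact ⟨_, ⟨{0}, by simp, rfl⟩, trivial⟩

theorem isIPStar_forall_finset {ι : Type*} (s : Finset ι) {P : ι → Finset ℕ → Prop}
    (h : ∀ i ∈ s, IsIPStar (P i)) : IsIPStar fun α => ∀ i ∈ s, P i α := by
  classical
  induction s using Finset.induction_on with
  | empty => simpa using isIPStar_true
  | insert a s _ ih =>
    have := (h a (Finset.mem_insert_self _ _)).and
      (ih fun i hi => h i (Finset.mem_insert_of_mem hi))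
    simpa [Finset.forall_mem_insert] using this

/-- The part of an IP-ring beyond a finite set is an IP-ring, up to passing to a subring. -/
theorem IsIPRing.exists_tail {R : Set (Finset ℕ)} (hR : IsIPRing R) (γ : Finset ℕ) :
    ∃ R', IsIPRing R' ∧ R' ⊆ R ∧ ∀ α ∈ R', Before γ α := by
  obtain ⟨a, hne, ha, rfl⟩ := hR
  have hge : ∀ i, ∀ x ∈ a i, i ≤ x := by
    intro i
    induction i with
    | zero => intro x _; exact Nat.zero_le x
    | succ i ih =>
      intro x hx
      obtain ⟨c, hc⟩ := hne i
      exact (ih c hc).trans_lt (ha i c hc x hx)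
  refine ⟨_, ⟨fun i => a (i + (γ.sup id + 1)), fun i => hne _, fun i => ?_, rfl⟩, ?_, ?_⟩
  · exact before_of_lt hne ha (by omega)
  · rintro _ ⟨β, hβ, rfl⟩
    refine ⟨β.image (· + (γ.sup id + 1)), hβ.image _, ?_⟩
    rw [Finset.image_biUnion]
  · rintro _ ⟨β, -, rfl⟩ x hx y hy
    obtain ⟨i, -, hy⟩ := Finset.mem_biUnion.1 hy
    have h1 := hge _ y hy
    have h2 : x ≤ γ.sup id := Finset.le_sup (f := id) hx
    omega

theorem IsIPRing.union_mem {R : Set (Finset ℕ)} (hR : IsIPRing R) {α β : Finset ℕ}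
    (hα : α ∈ R) (hβ : β ∈ R) : α ∪ β ∈ R := by
  obtain ⟨a, -, -, rfl⟩ := hR
  obtain ⟨s, hs, rfl⟩ := hα
  obtain ⟨t, -, rfl⟩ := hβ
  exact ⟨s ∪ t, hs.mono Finset.subset_union_left, (Finset.union_biUnion).symm⟩

theorem ipSum_union (n : ℕ → ℤ) {α β : Finset ℕ} (h : Before α β) :
    ipSum n (α ∪ β) = ipSum n α + ipSum n β :=
  Finset.sum_union h.disjoint

/-- Every IP-ring contains an index whose sum is divisible by a given `q ≠ 0`. -/
theorem isIPStar_dvd_ipSum (n : ℕ → ℤ) {q : ℕ} (hq : q ≠ 0) :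
    IsIPStar fun α => (q : ℤ) ∣ ipSum n α := by
  rintro _ ⟨a, hne, ha, rfl⟩
  have : NeZero q := ⟨hq⟩
  -- Two of the partial sums over the generators agree modulo `q`; the blocks between them have sum
  -- divisible by `q`.
  let u : ℕ → ℤ := fun i => ipSum n ((Finset.range i).biUnion a)
  have hdisj : ∀ i j, i ≠ j → Disjoint (a i) (a j) := by
    intro i j hij
    rcases lt_or_gt_of_ne hij with h | h
    · exact (before_of_lt hne ha h).disjoint
    · exact (before_of_lt hne ha h).disjoint.symm
  obtain ⟨i, j, hij, h⟩ := Finite.exists_ne_map_eq_of_infinite fun i => ((u i : ℤ) : ZMod q)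
  wlog hlt : i < j generalizing i j
  · exact this j i hij.symm h.symm (lt_of_le_of_ne (not_lt.1 hlt) hij.symm)
  refine ⟨_, ⟨Finset.Ico i j, by simpa using hlt, rfl⟩, ?_⟩
  have h1 : u j = u i + ipSum n ((Finset.Ico i j).biUnion a) := by
    simp only [u, ipSum]
    rw [← Finset.sum_union, ← Finset.union_biUnion, Finset.range_eq_Ico, Finset.range_eq_Ico,
      Finset.Ico_union_Ico_eq_Ico (Nat.zero_le i) hlt.le]
    rw [Finset.disjoint_biUnion_left]
    intro x hx
    rw [Finset.disjoint_biUnion_right]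
    intro y hy
    apply hdisj
    have := Finset.mem_range.1 hx
    have := (Finset.mem_Ico.1 hy).1
    omega
  have h2 : ((ipSum n ((Finset.Ico i j).biUnion a) : ℤ) : ZMod q) = 0 := by
    have : ((u j : ℤ) : ZMod q) = u i + (ipSum n ((Finset.Ico i j).biUnion a) : ℤ) := by
      rw [h1]; push_cast; rfl
    rw [← h] at this
    simpa using this.symm
  exact (ZMod.intCast_zmod_eq_zero_iff_dvd _ _).1 h2

end IPSystem

namespace IPSystem

open Polynomial

/-! ### Shifts of polynomials and the weight of a finite family -/

variable {L : Type*} [CommRing L]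

/-- The polynomial `P (X + m) - P m`. -/
noncomputable def shiftSub (m : L) (P : L[X]) : L[X] :=
  taylor m P - C (P.eval m)

theorem shiftSub_eval (m x : L) (P : L[X]) :
    (shiftSub m P).eval x = P.eval (x + m) - P.eval m := by
  simp [shiftSub, taylor_eval]

theorem natDegree_shiftSub (m : L) (P : L[X]) : (shiftSub m P).natDegree = P.natDegree := by
  rw [shiftSub, natDegree_sub_C, natDegree_taylor]

theorem coeff_shiftSub_natDegree (m : L) {P : L[X]} (h : 1 ≤ P.natDegree) :
    (shiftSub m P).coeff P.natDegree = P.leadingCoeff := by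
  rw [shiftSub, coeff_sub, coeff_taylor_natDegree, coeff_C_of_ne_zero (by omega), sub_zero]

theorem shiftSub_right_injective {m : L} {P Q : L[X]} (hP : P.eval 0 = 0) (hQ : Q.eval 0 = 0)
    (h : shiftSub m P = shiftSub m Q) : P = Q := by
  have h1 : taylor m (P - Q) = taylor m (C ((P - Q).eval m)) := by
    rw [taylor_C, map_sub, eval_sub, C_sub]
    simp only [shiftSub] at h
    linear_combination h
  have h2 := taylor_injective m h1
  have h3 : (P - Q).eval m = 0 := by
    have := congrArg (eval 0) h2
    simpa [hP, hQ] using this.symm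
  rw [h3, C_0] at h2
  exact sub_eq_zero.1 h2

/-- Otherwise `P (x + e) = P x + c` with `e ≠ 0`, so `P` is affine on the multiples of `e`, hence of
degree at most one. -/
theorem shiftSub_left_injective [IsDomain L] [CharZero L] {P : L[X]} (hP : 2 ≤ P.natDegree)
    {m₁ m₂ : L} (h : shiftSub m₁ P = shiftSub m₂ P) : m₁ = m₂ := by
  by_contra hne
  set e := m₁ - m₂ with he
  have he0 : e ≠ 0 := sub_ne_zero.2 hne
  set c := P.eval m₁ - P.eval m₂ with hc
  have hstep : ∀ x, P.eval (x + e) = P.eval x + c := by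
    intro x
    have := congrArg (eval (x - m₂)) h
    rw [shiftSub_eval, shiftSub_eval, show x - m₂ + m₁ = x + e by rw [he]; ring,
      sub_add_cancel] at this
    rw [hc]; linear_combination this
  have hk : ∀ k : ℕ, P.eval (k * e) = P.eval 0 + k * c := by
    intro k
    induction k with
    | zero => simp
    | succ k ih =>
      push_cast
      rw [add_mul, one_mul, hstep, ih]; ring
  have hpoly : P.comp (C e * X) = C c * X + C (P.eval 0) := by
    apply Polynomial.eq_of_infinite_eval_eq
    refine Set.Infinite.mono ?_ (Set.infinite_range_of_injective (Nat.cast_injective (R := L)))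
    rintro _ ⟨k, rfl⟩
    simp only [Set.mem_ofPred_eq, eval_comp, eval_mul, eval_C, eval_X, eval_add]
    rw [mul_comm e, hk]; ring
  have hdeg := congrArg natDegree hpoly
  rw [natDegree_comp, natDegree_C_mul_X e he0, mul_one] at hdeg
  have := natDegree_linear_le (a := c) (b := P.eval 0)
  omega

/-- The leading coefficients of the polynomials of degree `e` in `A`. -/
noncomputable def leadCoeffs (A : Finset L[X]) (e : ℕ) : Finset L := by
  classical exact (A.filter fun P => P.natDegree = e).image leadingCoeff

theorem mem_leadCoeffs {A : Finset L[X]} {e : ℕ} {c : L} :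
    c ∈ leadCoeffs A e ↔ ∃ P ∈ A, P.natDegree = e ∧ P.leadingCoeff = c := by
  simp [leadCoeffs, and_assoc]

/-- The weight of a finite family of polynomials: the number of leading coefficients occurring in
each degree. -/
noncomputable def weight (A : Finset L[X]) : ℕ →₀ ℕ :=
  Finsupp.onFinset (A.image natDegree) (fun e => (leadCoeffs A e).card) (by
    intro e he
    obtain ⟨c, hc⟩ := Finset.card_pos.1 (Nat.pos_of_ne_zero he)
    obtain ⟨P, hP, h, -⟩ := mem_leadCoeffs.1 hc
    exact Finset.mem_image.2 ⟨P, hP, h⟩)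

/-- Comparison of weights at the highest degree where they differ. -/
def WeightLT : (ℕ →₀ ℕ) → (ℕ →₀ ℕ) → Prop :=
  Finsupp.Lex (· > ·) (· < ·)

/-- Finite supports bound the degrees that occur, so comparison from the top degree cannot descend
forever. -/
theorem weightLT_wellFounded : WellFounded WeightLT :=
  Finsupp.Lex.wellFounded' (fun n => Nat.not_lt_zero n) wellFounded_lt wellFounded_lt

/-- Shifting a family of polynomials and subtracting a shift of a member of minimal degree lowers
the weight. -/
theorem weightLT_of_shift {A B : Finset L[X]} {h : L[X]} {m₀ : L} (hA : h ∈ A)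
    (hd : 1 ≤ h.natDegree) (hmin : ∀ P ∈ A, 1 ≤ P.natDegree → h.natDegree ≤ P.natDegree)
    (hB : ∀ Q ∈ B, ∃ P ∈ A, 1 ≤ P.natDegree ∧ ∃ m, Q = shiftSub m P - shiftSub m₀ h)
    (hAB : ∀ P ∈ A, 1 ≤ P.natDegree → ∃ m, shiftSub m P - shiftSub m₀ h ∈ B) :
    WeightLT (weight B) (weight A) := by
  classical
  have hdeg : ∀ P : L[X], ∀ m, h.natDegree < P.natDegree →
      (shiftSub m P - shiftSub m₀ h).natDegree = P.natDegree ∧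
      (shiftSub m P - shiftSub m₀ h).leadingCoeff = P.leadingCoeff := by
    intro P m hP
    have h1 : (shiftSub m P - shiftSub m₀ h).natDegree = P.natDegree := by
      rw [natDegree_sub_eq_left_of_natDegree_lt, natDegree_shiftSub]
      rwa [natDegree_shiftSub, natDegree_shiftSub]
    refine ⟨h1, ?_⟩
    rw [leadingCoeff, h1, coeff_sub, coeff_shiftSub_natDegree m (by omega),
      coeff_eq_zero_of_natDegree_lt (by rwa [natDegree_shiftSub]), sub_zero]
  have hle : ∀ P : L[X], ∀ m, P.natDegree = h.natDegree →
      (shiftSub m P - shiftSub m₀ h).natDegree ≤ h.natDegree := by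
    intro P m hP
    refine (natDegree_sub_le _ _).trans ?_
    rw [natDegree_shiftSub, natDegree_shiftSub, hP, max_self]
  -- The weights first differ at the degree of `h`: higher counts are unchanged, and lower ones may
  -- grow freely.
  refine ⟨h.natDegree, ?_, ?_⟩
  · intro e he
    change (leadCoeffs B e).card = (leadCoeffs A e).card
    congr 1
    ext c
    rw [mem_leadCoeffs, mem_leadCoeffs]
    have he' : h.natDegree < e := he
    constructor
    · rintro ⟨Q, hQ, rfl, rfl⟩
      obtain ⟨P, hP, hP1, m, rfl⟩ := hB Q hQ
      rcases (hmin P hP hP1).lt_or_eq with hlt | heq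
      · exact ⟨P, hP, (hdeg P m hlt).1.symm, (hdeg P m hlt).2.symm⟩
      · exact absurd (hle P m heq.symm) (not_le.2 he')
    · rintro ⟨P, hP, rfl, rfl⟩
      obtain ⟨m, hm⟩ := hAB P hP (by omega)
      exact ⟨_, hm, hdeg P m he'⟩
  · change (leadCoeffs B h.natDegree).card < (leadCoeffs A h.natDegree).card
    have hlc : h.leadingCoeff ∈ leadCoeffs A h.natDegree := mem_leadCoeffs.2 ⟨h, hA, rfl, rfl⟩
    -- In the degree of `h` all leading coefficients are translated by that of `h`; polynomials
    -- sharing it drop in degree, so one value is lost.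
    refine lt_of_le_of_lt (Finset.card_le_card (t := ((leadCoeffs A h.natDegree).erase
      h.leadingCoeff).image (· - h.leadingCoeff)) ?_)
      (Finset.card_image_le.trans_lt (Finset.card_erase_lt_of_mem hlc))
    intro c hc
    obtain ⟨Q, hQ, hQd, rfl⟩ := mem_leadCoeffs.1 hc
    obtain ⟨P, hP, hP1, m, rfl⟩ := hB Q hQ
    have hPd : P.natDegree = h.natDegree := by
      rcases (hmin P hP hP1).lt_or_eq with hlt | heq
      · have := (hdeg P m hlt).1
        omega
      · exact heq.symm
    have hcoeff : (shiftSub m P - shiftSub m₀ h).leadingCoeff =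
        P.leadingCoeff - h.leadingCoeff := by
      rw [leadingCoeff, hQd, coeff_sub, coeff_shiftSub_natDegree m₀ hd, ← hPd,
        coeff_shiftSub_natDegree m hP1]
    refine Finset.mem_image.2 ⟨P.leadingCoeff, Finset.mem_erase.2 ⟨?_, ?_⟩, hcoeff.symm⟩
    · intro heq
      rw [heq, sub_self, leadingCoeff_eq_zero] at hcoeff
      rw [hcoeff, natDegree_zero] at hQd
      omega
    · exact mem_leadCoeffs.2 ⟨P, hP, hPd, rfl⟩

end IPSystem

namespace IPSystem

open Polynomial

/-! ### Polynomial multiple mixing by PET induction -/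

section PET

variable {X Γ L : Type*} [TopologicalSpace X] [CommGroup Γ] [MulAction Γ X]
  [ContinuousConstSMul Γ X] [CommRing L]

/-- Polynomials vanishing at `0` whose values at the integers lie in the additive subgroup `Λ`. -/
def Admissible (Λ : AddSubgroup L) (P : L[X]) : Prop :=
  P.eval 0 = 0 ∧ ∀ m : ℤ, P.eval (m : L) ∈ Λ

theorem Admissible.shiftSub {Λ : AddSubgroup L} {P : L[X]} (hP : Admissible Λ P) (m : ℤ) :
    Admissible Λ (shiftSub (m : L) P) := by
  refine ⟨by rw [shiftSub_eval, zero_add, sub_self], fun k => ?_⟩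
  rw [shiftSub_eval, ← Int.cast_add]
  exact Λ.sub_mem (hP.2 _) (hP.2 _)

theorem Admissible.sub {Λ : AddSubgroup L} {P Q : L[X]} (hP : Admissible Λ P)
    (hQ : Admissible Λ Q) : Admissible Λ (P - Q) :=
  ⟨by rw [eval_sub, hP.1, hQ.1, sub_zero], fun m => by
    rw [eval_sub]; exact Λ.sub_mem (hP.2 m) (hQ.2 m)⟩

theorem Admissible.eq_zero {Λ : AddSubgroup L} {P : L[X]} (hP : Admissible Λ P)
    (h : P.natDegree = 0) : P = 0 := by
  have h1 := eq_C_of_natDegree_eq_zero h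
  have h2 := hP.1
  rw [h1, eval_C] at h2
  rw [h1, h2, C_0]

theorem Admissible.eq_C_mul_X {Λ : AddSubgroup L} {P : L[X]} (hP : Admissible Λ P)
    (h : P.natDegree = 1) : P = C P.leadingCoeff * Polynomial.X := by
  obtain ⟨a, -, b, h2⟩ := natDegree_eq_one.1 h
  have h3 := hP.1
  have hlc : P.leadingCoeff = a := by
    rw [leadingCoeff, h, ← h2]; simp
  rw [← h2] at h3
  simp only [eval_add, eval_mul, eval_C, eval_X, mul_zero, zero_add] at h3
  rw [hlc, ← h2, h3, C_0, add_zero]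

variable (Λ : AddSubgroup L) (f : L → Γ)

theorem map_intCast_mul (hf : ∀ a ∈ Λ, ∀ b ∈ Λ, f (a + b) = f a * f b) {a : L} (ha : a ∈ Λ)
    (m : ℤ) : f (m * a) = f a ^ m := by
  let φ : Λ →+ Additive Γ :=
    AddMonoidHom.mk' (fun a => Additive.ofMul (f a)) fun a b => by
      rw [← ofMul_mul, ← hf a a.2 b b.2]; rfl
  have h := map_zsmul φ m ⟨a, ha⟩
  rw [← zsmul_eq_mul]
  exact h

/-- The translates of a nonempty open set along a nontrivial linear polynomial meet any other
nonempty open set. -/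
theorem isIPStar_linear {n : ℕ → ℤ} (hf : ∀ a ∈ Λ, ∀ b ∈ Λ, f (a + b) = f a * f b)
    (hmix : ∀ a ∈ Λ, a ≠ 0 → IsMixingAlong X n (f a)) {P : L[X]} (hP : Admissible Λ P)
    (hdeg : P.natDegree = 1) (t : Γ) {U V : Set X} (hU : IsOpen U) (hV : IsOpen V)
    (hUne : U.Nonempty) (hVne : V.Nonempty) :
    IsIPStar fun α => (U ∩ {x | (t * f (P.eval (ipSum n α : L))) • x ∈ V}).Nonempty := by
  have hPeq := hP.eq_C_mul_X hdeg
  set a := P.leadingCoeff with ha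
  have ha0 : a ≠ 0 := by
    rw [ha, Ne, leadingCoeff_eq_zero]
    rintro rfl
    simp at hdeg
  have haΛ : a ∈ Λ := by
    have := hP.2 1
    rw [hPeq] at this
    simpa using this
  intro R hR
  obtain ⟨y, hy⟩ := hVne
  obtain ⟨α, hα, x, hxU, hx⟩ := hmix a haΛ ha0 U ((fun x => t • x) ⁻¹' V) hU
    (hV.preimage (continuous_const_smul t)) hUne ⟨t⁻¹ • y, by simpa using hy⟩ R hR
  refine ⟨α, hα, x, hxU, ?_⟩
  have h2 : P.eval (ipSum n α : L) = (ipSum n α : ℤ) * a := by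
    have := congrArg (eval (ipSum n α : L)) hPeq
    rwa [eval_mul, eval_C, eval_X, mul_comm] at this
  rw [Set.mem_ofPred_eq, h2, map_intCast_mul Λ f hf haΛ, mul_smul]
  exact hx

/-- At most one integer shift of `P` equals `Q`, and `hn` avoids that value. -/
theorem isIPStar_shiftSub_ne [IsDomain L] [CharZero L] {n : ℕ → ℤ}
    (hn : ∀ c : ℤ, IsIPStar fun α => ipSum n α ≠ c) {P : L[X]} (hP : 2 ≤ P.natDegree)
    (Q : L[X]) : IsIPStar fun α => shiftSub (ipSum n α : L) P ≠ Q := by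
  intro R hR
  by_cases h : ∃ c : ℤ, shiftSub (c : L) P = Q
  · obtain ⟨c, hc⟩ := h
    obtain ⟨α, hα, hαc⟩ := hn c R hR
    refine ⟨α, hα, fun heq => hαc ?_⟩
    exact Int.cast_injective (shiftSub_left_injective hP (heq.trans hc.symm))
  · obtain ⟨α, hα, -⟩ := isIPStar_true R hR
    exact ⟨α, hα, fun heq => h ⟨_, heq⟩⟩

/-- Choice of the shifts in the PET induction: the shrunken sets `W P` take care of the linear
polynomials and the shifts of the polynomials of higher degree are pairwise distinct. -/
theorem exists_shifts [IsDomain L] [CharZero L] {n : ℕ → ℤ}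
    (hf : ∀ a ∈ Λ, ∀ b ∈ Λ, f (a + b) = f a * f b)
    (hmix : ∀ a ∈ Λ, a ≠ 0 → IsMixingAlong X n (f a))
    (hn : ∀ c : ℤ, IsIPStar fun α => ipSum n α ≠ c)
    (A : Finset L[X]) (hA : ∀ P ∈ A, Admissible Λ P) (V : L[X] → Set X)
    (hV : ∀ P, IsOpen (V P)) (hVne : ∀ P, (V P).Nonempty) {R : Set (Finset ℕ)} (hR : IsIPRing R)
    (F : Finset Γ) :
    ∃ (β : Γ → Finset ℕ) (W : L[X] → Set X), (∀ t ∈ F, β t ∈ R) ∧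
      (∀ P ∈ A, P.natDegree = 1 → IsOpen (W P) ∧ (W P).Nonempty ∧
        ∀ t ∈ F, ∀ x ∈ W P, (t * f (P.eval (ipSum n (β t) : L))) • x ∈ V P) ∧
      ∀ t ∈ F, ∀ t' ∈ F, ∀ P ∈ A, ∀ Q ∈ A, 2 ≤ P.natDegree → 2 ≤ Q.natDegree →
        shiftSub (ipSum n (β t) : L) P = shiftSub (ipSum n (β t') : L) Q → t = t' := by
  classical
  induction F using Finset.induction_on with
  | empty => exact ⟨fun _ => ∅, V, by simp, fun P _ _ => ⟨hV P, hVne P, by simp⟩, by simp⟩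
  | insert t₀ F ht₀ ih =>
    obtain ⟨β, W, hβ, hW, hdist⟩ := ih
    have h₁ : IsIPStar fun α => ∀ P ∈ A.filter fun P => P.natDegree = 1,
        (W P ∩ {x | (t₀ * f (P.eval (ipSum n α : L))) • x ∈ V P}).Nonempty := by
      refine isIPStar_forall_finset _ fun P hP => ?_
      obtain ⟨hPA, hP1⟩ := Finset.mem_filter.1 hP
      exact isIPStar_linear Λ f hf hmix (hA P hPA) hP1 t₀ (hW P hPA hP1).1 (hV P)
        (hW P hPA hP1).2.1 (hVne P)
    -- New shifts must differ from all earlier ones, including those of other members of `A`.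
    have h₂ : IsIPStar fun α => ∀ P ∈ A.filter fun P => 2 ≤ P.natDegree, ∀ s ∈ F ×ˢ A,
        shiftSub (ipSum n α : L) P ≠ shiftSub (ipSum n (β s.1) : L) s.2 :=
      isIPStar_forall_finset _ fun P hP => isIPStar_forall_finset _ fun s _ =>
        isIPStar_shiftSub_ne hn (Finset.mem_filter.1 hP).2 _
    obtain ⟨α, hα, hα₁, hα₂⟩ := (h₁.and h₂) R hR
    have hne : ∀ t ∈ F, t ≠ t₀ := fun t ht h => ht₀ (h ▸ ht)
    have hα₂' : ∀ t ∈ F, ∀ P ∈ A, ∀ Q ∈ A, 2 ≤ P.natDegree →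
        shiftSub (ipSum n α : L) P ≠ shiftSub (ipSum n (β t) : L) Q := fun t ht P hP Q hQ hP2 =>
      hα₂ P (Finset.mem_filter.2 ⟨hP, hP2⟩) (t, Q) (Finset.mem_product.2 ⟨ht, hQ⟩)
    refine ⟨Function.update β t₀ α,
      fun P => W P ∩ {x | (t₀ * f (P.eval (ipSum n α : L))) • x ∈ V P}, ?_, ?_, ?_⟩
    · intro t ht
      rcases Finset.mem_insert.1 ht with rfl | ht
      · simpa using hα
      · simpa [hne t ht] using hβ t ht
    · intro P hP hP1
      obtain ⟨hWo, -, hWt⟩ := hW P hP hP1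
      refine ⟨hWo.inter ((hV P).preimage (continuous_const_smul _)),
        hα₁ P (Finset.mem_filter.2 ⟨hP, hP1⟩), ?_⟩
      intro t ht x hx
      rcases Finset.mem_insert.1 ht with rfl | ht
      · simpa using hx.2
      · simpa [hne t ht] using hWt t ht x hx.1
    · intro t ht t' ht' P hP Q hQ hP2 hQ2 heq
      rcases Finset.mem_insert.1 ht with rfl | hs <;>
        rcases Finset.mem_insert.1 ht' with rfl | hs'
      · rfl
      · rw [Function.update_self, Function.update_of_ne (hne t' hs')] at heq
        exact absurd heq (hα₂' t' hs' P hP Q hQ hP2)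
      · rw [Function.update_self, Function.update_of_ne (hne t hs)] at heq
        exact absurd heq.symm (hα₂' t hs Q hQ P hP hQ2)
      · rw [Function.update_of_ne (hne t hs), Function.update_of_ne (hne t' hs')] at heq
        exact hdist t hs t' hs' P hP Q hQ hP2 hQ2 heq

/-- For finitely many distinct polynomials vanishing at `0`, one point can be moved simultaneously
into prescribed nonempty open sets by elements of the group along the IP-ring. -/
theorem exists_forall_smul_mem [CompactSpace X] [Nonempty X] [MulAction.IsMinimal Γ X]
    [IsDomain L] [CharZero L] {n : ℕ → ℤ}
    (hf : ∀ a ∈ Λ, ∀ b ∈ Λ, f (a + b) = f a * f b)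
    (hmix : ∀ a ∈ Λ, a ≠ 0 → IsMixingAlong X n (f a))
    (hn : ∀ c : ℤ, IsIPStar fun α => ipSum n α ≠ c)
    (A : Finset L[X]) (hA : ∀ P ∈ A, Admissible Λ P) (V : L[X] → Set X)
    (hV : ∀ P, IsOpen (V P)) (hVne : ∀ P, (V P).Nonempty) {R : Set (Finset ℕ)}
    (hR : IsIPRing R) :
    ∃ α ∈ R, ∃ x : X, ∀ P ∈ A, f (P.eval (ipSum n α : L)) • x ∈ V P := by
  classical
  have hf0 : f 0 = 1 := by
    have := hf 0 Λ.zero_mem 0 Λ.zero_mem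
    rw [add_zero] at this
    exact left_eq_mul.1 this
  have hfsub : ∀ a ∈ Λ, ∀ b ∈ Λ, f (a - b) * f b = f a := fun a ha b hb => by
    rw [← hf _ (Λ.sub_mem ha hb) _ hb, sub_add_cancel]
  obtain ⟨w, hw⟩ : ∃ w, weight A = w := ⟨_, rfl⟩
  -- The targets and the ring vary too: the smaller family is treated with pulled-back targets and
  -- along a tail of `R`.
  induction w using weightLT_wellFounded.induction generalizing A V R with
  | _ w ih =>
  subst hw
  by_cases hne : ∃ P ∈ A, 1 ≤ P.natDegree
  swap
  · obtain ⟨x, hx⟩ := hVne 0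
    obtain ⟨α, hα, -⟩ := isIPStar_true R hR
    refine ⟨α, hα, x, fun P hP => ?_⟩
    have : P = 0 := (hA P hP).eq_zero (by
      by_contra h
      exact hne ⟨P, hP, Nat.one_le_iff_ne_zero.2 h⟩)
    rw [this, eval_zero, hf0, one_smul]
    exact hx
  obtain ⟨h, hhA, hmin⟩ := Finset.exists_min_image (A.filter fun P => 1 ≤ P.natDegree) natDegree
    (by obtain ⟨P, hP, h⟩ := hne; exact ⟨P, Finset.mem_filter.2 ⟨hP, h⟩⟩)
  obtain ⟨hhA, hh1⟩ := Finset.mem_filter.1 hhA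
  obtain ⟨F, hF⟩ := isCompact_univ.exists_finite_cover_smul Γ (hV 0) (hVne 0)
  obtain ⟨F, hF⟩ : ∃ F : Finset Γ, ∀ x : X, ∃ t ∈ F, t • x ∈ V 0 := by
    refine ⟨F.image (·⁻¹), fun x => ?_⟩
    obtain ⟨t, ht, hx⟩ := Set.mem_iUnion₂.1 (hF (Set.mem_univ x))
    exact ⟨t⁻¹, Finset.mem_image_of_mem _ ht, Set.mem_smul_set_iff_inv_smul_mem.1 hx⟩
  obtain ⟨t₀, ht₀⟩ : F.Nonempty := by
    obtain ⟨t, ht, -⟩ := hF (Classical.arbitrary X)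
    exact ⟨t, ht⟩
  obtain ⟨β, W, hβ, hW, hdist⟩ := exists_shifts Λ f hf hmix hn A hA V hV hVne hR F
  let m : Γ → L := fun t => (ipSum n (β t) : ℤ)
  -- A shifted polynomial of degree at least two determines both `t` and `P`, so the choice made in
  -- `V'` is the intended one.
  have hpair : ∀ t ∈ F, ∀ t' ∈ F, ∀ P ∈ A, ∀ Q ∈ A, 2 ≤ P.natDegree →
      shiftSub (m t) P = shiftSub (m t') Q → t = t' ∧ P = Q := by
    intro t ht t' ht' P hP Q hQ hP2 heq
    have hQ2 : 2 ≤ Q.natDegree := by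
      have := congrArg natDegree heq
      rw [natDegree_shiftSub, natDegree_shiftSub] at this
      omega
    obtain rfl := hdist t ht t' ht' P hP Q hQ hP2 hQ2 heq
    exact ⟨rfl, shiftSub_right_injective (hA P hP).1 (hA Q hQ).1 heq⟩
  -- the targets for the shifted family
  let V' : L[X] → Set X := fun Q =>
    if Q ∈ A ∧ Q.natDegree = 1 then W Q
    else if hQ : ∃ s : Γ × L[X], s.1 ∈ F ∧ s.2 ∈ A ∧ 2 ≤ s.2.natDegree ∧
        shiftSub (m s.1) s.2 = Q then
      {x | (hQ.choose.1 * f (hQ.choose.2.eval (m hQ.choose.1))) • x ∈ V hQ.choose.2}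
    else Set.univ
  have hV' : ∀ Q, IsOpen (V' Q) := by
    intro Q
    simp only [V']
    split_ifs with h1 h2
    · exact (hW Q h1.1 h1.2).1
    · exact (hV _).preimage (continuous_const_smul _)
    · exact isOpen_univ
  have hV'ne : ∀ Q, (V' Q).Nonempty := by
    intro Q
    simp only [V']
    split_ifs with h1 h2
    · exact (hW Q h1.1 h1.2).2.1
    · obtain ⟨y, hy⟩ := hVne h2.choose.2
      exact ⟨(h2.choose.1 * f (h2.choose.2.eval (m h2.choose.1)))⁻¹ • y, by
        rw [Set.mem_ofPred_eq, smul_inv_smul]; exact hy⟩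
    · exact Set.univ_nonempty
  have hV'mem : ∀ t ∈ F, ∀ P ∈ A, 1 ≤ P.natDegree → ∀ x ∈ V' (shiftSub (m t) P),
      (t * f (P.eval (m t))) • x ∈ V P := by
    intro t ht P hP hP1 x hx
    rcases hP1.eq_or_lt with h1 | h2
    · have hs : shiftSub (m t) P = P := by
        rw [shiftSub, (hA P hP).eq_C_mul_X h1.symm]
        simp [taylor_apply, mul_add]
      have : V' P = W P := if_pos ⟨hP, h1.symm⟩
      rw [hs, this] at hx
      exact (hW P hP h1.symm).2.2 t ht x hx
    · have hne1 : ¬ (shiftSub (m t) P ∈ A ∧ (shiftSub (m t) P).natDegree = 1) := by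
        rw [natDegree_shiftSub]
        omega
      have hex : ∃ s : Γ × L[X], s.1 ∈ F ∧ s.2 ∈ A ∧ 2 ≤ s.2.natDegree ∧
          shiftSub (m s.1) s.2 = shiftSub (m t) P := ⟨(t, P), ht, hP, h2, rfl⟩
      obtain ⟨hc1, hc2, hc3, hc4⟩ := hex.choose_spec
      obtain ⟨e1, e2⟩ := hpair _ hc1 _ ht _ hc2 _ hP hc3 hc4
      simp only [V'] at hx
      rw [if_neg hne1, dif_pos hex, e1, e2] at hx
      exact hx
  let h' := shiftSub (m t₀) h
  have hh' : Admissible Λ h' := (hA h hhA).shiftSub _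
  let B : Finset L[X] := (F ×ˢ A.filter fun P => 1 ≤ P.natDegree).image
    fun s => shiftSub (m s.1) s.2 - h'
  have hBmem : ∀ t ∈ F, ∀ P ∈ A, 1 ≤ P.natDegree → shiftSub (m t) P - h' ∈ B :=
    fun t ht P hP hP1 => Finset.mem_image.2
      ⟨(t, P), Finset.mem_product.2 ⟨ht, Finset.mem_filter.2 ⟨hP, hP1⟩⟩, rfl⟩
  have hBex : ∀ Q ∈ B, ∃ P ∈ A, 1 ≤ P.natDegree ∧ ∃ t ∈ F, Q = shiftSub (m t) P - h' := by
    intro Q hQ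
    obtain ⟨s, hs, rfl⟩ := Finset.mem_image.1 hQ
    obtain ⟨hs1, hs2⟩ := Finset.mem_product.1 hs
    obtain ⟨hs2, hs3⟩ := Finset.mem_filter.1 hs2
    exact ⟨s.2, hs2, hs3, s.1, hs1, rfl⟩
  have hBadm : ∀ Q ∈ B, Admissible Λ Q := by
    intro Q hQ
    obtain ⟨P, hP, -, t, -, rfl⟩ := hBex Q hQ
    exact ((hA P hP).shiftSub _).sub hh'
  have hlt : WeightLT (weight B) (weight A) := by
    refine weightLT_of_shift hhA hh1
      (fun P hP hP1 => hmin P (Finset.mem_filter.2 ⟨hP, hP1⟩)) (m₀ := m t₀) ?_ ?_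
    · intro Q hQ
      obtain ⟨P, hP, hP1, t, -, rfl⟩ := hBex Q hQ
      exact ⟨P, hP, hP1, m t, rfl⟩
    · exact fun P hP hP1 => ⟨m t₀, hBmem t₀ ht₀ P hP hP1⟩
  -- Beyond all the `β t`, sums are additive on `β t ∪ α` for whichever `t` is selected afterwards.
  obtain ⟨R', hR', hR'R, hR'b⟩ := hR.exists_tail (F.biUnion β)
  obtain ⟨α, hα, x, hx⟩ := ih _ hlt B hBadm (fun Q => V' (Q + h')) (fun Q => hV' _)
    (fun Q => hV'ne _) hR' rfl
  -- Only now is `t` chosen: it brings the point into `V 0`, the target of the zero polynomial.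
  obtain ⟨t, ht, htx⟩ := hF ((f (h'.eval (ipSum n α : L)))⁻¹ • x)
  have hbef : Before (β t) α := fun a ha b hb =>
    hR'b α hα a (Finset.mem_biUnion.2 ⟨t, ht, ha⟩) b hb
  refine ⟨β t ∪ α, hR.union_mem (hβ t ht) (hR'R hα),
    t • (f (h'.eval (ipSum n α : L)))⁻¹ • x, fun P hP => ?_⟩
  rcases Nat.eq_zero_or_pos P.natDegree with h0 | hP1
  · rw [(hA P hP).eq_zero h0, eval_zero, hf0, one_smul]
    exact htx
  · have h1 := hx _ (hBmem t ht P hP hP1)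
    simp only [sub_add_cancel] at h1
    have h2 := hV'mem t ht P hP hP1 _ h1
    -- Since `P (n_α + m t) = P (m t) + (shiftSub (m t) P) (n_α)`, the factor for `h'` splits off
    -- and cancels its inverse in the chosen point.
    have h3 : f (P.eval (ipSum n (β t ∪ α) : L)) =
        f (P.eval (m t)) * f ((shiftSub (m t) P - h').eval (ipSum n α : L)) *
          f (h'.eval (ipSum n α : L)) := by
      rw [mul_assoc, eval_sub, hfsub _ (((hA P hP).shiftSub _).2 _) _ (hh'.2 _),
        ← hf _ ((hA P hP).2 _) _ (((hA P hP).shiftSub _).2 _), shiftSub_eval, ipSum_union n hbef]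
      have h4 : ((ipSum n (β t) + ipSum n α : ℤ) : L) = ipSum n α + m t := by
        rw [Int.cast_add, add_comm]
      rw [h4, add_sub_cancel]
    rw [h3]
    rw [smul_smul] at h2
    have h4 : ∀ a b c : Γ, a * b * c * t * c⁻¹ = t * a * b := fun a b c => by
      rw [mul_right_comm, mul_inv_cancel_right, mul_comm, mul_assoc]
    rw [smul_smul, smul_smul, h4]
    exact h2

end PET

end IPSystem

namespace IPSystem

open Polynomial

/-! ### Torsion-freeness of the acting group and coordinates on it -/

section Acting

variable {X Γ : Type*} [MetricSpace X] [CommGroup Γ] [MulAction Γ X] {n : ℕ → ℤ}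

theorem IsMixingAlong.not_forall_pow_eq_one [Nontrivial X] {T : Γ}
    (hT : IsMixingAlong X n T) {R : Set (Finset ℕ)} (hR : IsIPRing R) :
    ¬ ∀ α ∈ R, T ^ ipSum n α = 1 := by
  intro h
  obtain ⟨x, y, hxy⟩ := exists_pair_ne X
  obtain ⟨U, V, hU, hV, hx, hy, hUV⟩ := t2_separation hxy
  obtain ⟨α, hα, z, hzU, hzV⟩ := hT U V hU hV ⟨x, hx⟩ ⟨y, hy⟩ R hR
  rw [Set.mem_ofPred_eq, h α hα, one_smul] at hzV
  exact Set.disjoint_left.1 hUV hzU hzV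

/-- A constant value `c` on a ring satisfies `c = c + c` by additivity, and `c = 0` contradicts
mixing. -/
theorem isIPStar_ipSum_ne [Nontrivial X] {T : Γ} (hT : IsMixingAlong X n T) (c : ℤ) :
    IsIPStar fun α => ipSum n α ≠ c := by
  intro R hR
  by_contra! h
  obtain ⟨α, hα, -⟩ := isIPStar_true R hR
  obtain ⟨R', hR', hR'R, hb⟩ := hR.exists_tail α
  obtain ⟨β, hβ, -⟩ := isIPStar_true R' hR'
  have h1 := ipSum_union n (hb β hβ)
  rw [h _ hα, h _ (hR'R hβ), h _ (hR.union_mem hα (hR'R hβ))] at h1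
  obtain rfl : c = 0 := by omega
  exact hT.not_forall_pow_eq_one hR fun α hα => by rw [h α hα, zpow_zero]

theorem IsMixingAlong.pow_ne_one [Nontrivial X] {T : Γ} (hT : IsMixingAlong X n T) {q : ℕ}
    (hq : q ≠ 0) : T ^ q ≠ 1 := by
  intro h
  have huniv : IsIPRing {α | ∃ β : Finset ℕ, β.Nonempty ∧ α = β.biUnion fun i => {i}} :=
    ⟨fun i => {i}, by simp, fun i => by simp [Before], rfl⟩
  obtain ⟨R, hR, -, hdvd⟩ := huniv.exists_subring (isIPStar_dvd_ipSum n hq)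
  refine hT.not_forall_pow_eq_one hR fun α hα => ?_
  obtain ⟨k, hk⟩ := hdvd α hα
  rw [hk, zpow_mul, zpow_natCast, h, one_zpow]

end Acting

/-- A finitely generated subgroup of a torsion-free abelian group embeds into `ℚ[X]`. -/
theorem exists_embedding_polynomial {Γ : Type*} [CommGroup Γ]
    (htf : ∀ T : Γ, T ≠ 1 → ∀ q : ℕ, q ≠ 0 → T ^ q ≠ 1) {d : ℕ} (T : Fin d → Γ) :
    ∃ ψ : Additive (Subgroup.closure (Set.range T)) →+ ℚ[X], Function.Injective ψ := by
  set H := Subgroup.closure (Set.range T) with hH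
  have hfg : AddGroup.FG (Additive H) := by
    have : Group.FG H := (Group.fg_iff_subgroup_fg H).2
      ((Subgroup.fg_iff _).2 ⟨_, hH.symm, Set.finite_range T⟩)
    infer_instance
  have : Module.Finite ℤ (Additive H) := Module.Finite.iff_addGroup_fg.2 hfg
  have : Module.IsTorsionFree ℤ (Additive H) := by
    refine Module.IsTorsionFree.of_smul_eq_zero fun k a ha => ?_
    by_contra! hka
    refine htf ((a.toMul : H) : Γ) (fun h => hka.2 (Subtype.ext h)) k.natAbs
      (Int.natAbs_ne_zero.2 hka.1) ?_
    rw [pow_natAbs_eq_one]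
    exact congrArg (fun x : Additive H => ((x.toMul : H) : Γ)) ha
  obtain ⟨r, ⟨b⟩⟩ : ∃ r : ℕ, Nonempty (Module.Basis (Fin r) ℤ (Additive H)) :=
    ⟨_, ⟨Module.finBasis ℤ (Additive H)⟩⟩
  -- The basis vector with index `l` goes to the monomial of degree `l`.
  refine ⟨∑ l : Fin r, (((monomial (l : ℕ) : ℚ →ₗ[ℚ] ℚ[X]).toAddMonoidHom).comp
    (Int.castAddHom ℚ)).comp (b.coord l).toAddMonoidHom, ?_⟩
  rw [injective_iff_map_eq_zero]
  intro a ha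
  refine b.ext_elem fun l => ?_
  have h := congrArg (fun p => coeff p l) ha
  simp [coeff_monomial, Fin.val_inj] at h
  simp [h]

/-- The polynomial expressions become polynomials in the coordinates. -/
theorem exists_polynomial_eval_eq {H : Type*} [CommGroup H] (ψ : Additive H →+ ℚ[X]) {d : ℕ}
    (T : Fin d → H) (p : Fin d → ℤ → ℤ) (hp : ∀ j, IsIntegralPolynomial (p j)) :
    ∃ P : ℚ[X][X], ∀ m : ℤ, P.eval (m : ℚ[X]) = ψ (Additive.ofMul (polyExpr T p m)) := by
  choose q hq using hp
  refine ⟨∑ j, C (ψ (Additive.ofMul (T j))) * (q j).map (C : ℚ →+* ℚ[X]), fun m => ?_⟩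
  rw [eval_finsetSum, polyExpr, ofMul_prod, map_sum]
  refine Finset.sum_congr rfl fun j _ => ?_
  rw [eval_mul, eval_C, eval_intCast_map, hq, ofMul_zpow, map_zsmul, zsmul_eq_mul, mul_comm,
    map_intCast]

/-- Recurrence of nonempty open sets along the expressions `g i`. -/
theorem exists_mem_forall_smul_mem {X Γ : Type*} [MetricSpace X] [CompactSpace X] [Nontrivial X]
    [CommGroup Γ] [MulAction Γ X] [ContinuousConstSMul Γ X] {n : ℕ → ℤ}
    (hΓ : ∀ T : Γ, T ≠ 1 → IsMixingAlong X n T ∧ MulAction.IsMinimal (Subgroup.zpowers T) X)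
    {d k : ℕ} (hk : 1 ≤ k) (T : Fin d → Γ) (p : Fin k → Fin d → ℤ → ℤ)
    (hp : ∀ i j, IsIntegralPolynomial (p i j))
    (hnontriv : ∀ i, DependsNontrivially (polyExpr T (p i)))
    (hdiff : ∀ i j, i ≠ j →
      DependsNontrivially fun m => polyExpr T (p i) m * (polyExpr T (p j) m)⁻¹)
    {R : Set (Finset ℕ)} (hR : IsIPRing R) {U : Set X} (hU : IsOpen U) (hUne : U.Nonempty)
    (V : Fin k → Set X) (hV : ∀ i, IsOpen (V i)) (hVne : ∀ i, (V i).Nonempty) :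
    ∃ α ∈ R, ∃ x ∈ U, ∀ i, polyExpr T (p i) (ipSum n α) • x ∈ V i := by
  classical
  -- One nontrivial element suffices for minimality of `Γ` and for `n_α` to avoid constants.
  obtain ⟨S, hS⟩ : ∃ S : Γ, S ≠ 1 := by
    by_contra! h
    exact hnontriv ⟨0, hk⟩ ⟨1, fun m => h _⟩
  have hmin : MulAction.IsMinimal Γ X := ⟨fun x =>
    ((hΓ S hS).2.dense_orbit x).mono (by rintro _ ⟨s, rfl⟩; exact ⟨s, rfl⟩)⟩
  let H := Subgroup.closure (Set.range T)
  obtain ⟨ψ, hψ⟩ : ∃ ψ : Additive H →+ ℚ[X], Function.Injective ψ :=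
    exists_embedding_polynomial (fun T hT q hq => (hΓ T hT).1.pow_ne_one hq) T
  let T' : Fin d → H := fun j => ⟨T j, Subgroup.subset_closure ⟨j, rfl⟩⟩
  have hT' : ∀ i m, ((polyExpr T' (p i) m : H) : Γ) = polyExpr T (p i) m := by
    intro i m
    simp [polyExpr, T']
  choose P hP using fun i => exists_polynomial_eval_eq ψ T' (p i) (hp i)
  -- The inverse of `ψ` on its range; the values elsewhere are arbitrary, so `f` is multiplicative
  -- only on `ψ.range`.
  let f : ℚ[X] → Γ := fun a => ((Function.invFun ψ a).toMul : H)
  have hfψ : ∀ h : Additive H, f (ψ h) = (h.toMul : H) := fun h => by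
    change ((Function.invFun ψ (ψ h)).toMul : Γ) = _
    rw [Function.leftInverse_invFun hψ h]
  have hf : ∀ a ∈ ψ.range, ∀ b ∈ ψ.range, f (a + b) = f a * f b := by
    rintro _ ⟨a, rfl⟩ _ ⟨b, rfl⟩
    rw [← map_add, hfψ, hfψ, hfψ]
    rfl
  have hmix : ∀ a ∈ ψ.range, a ≠ 0 → IsMixingAlong X n (f a) := by
    rintro _ ⟨a, rfl⟩ ha
    refine (hΓ _ fun h => ha ?_).1
    rw [hfψ] at h
    have : a = 0 := Subtype.ext h
    rw [this, map_zero]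
  -- Removing the constant terms makes the family vanish at `0`; the lost factors `polyExpr T (p i)
  -- 0` are absorbed into the targets `W`.
  let Q : Fin k → ℚ[X][X] := fun i => P i - C ((P i).eval 0)
  have hQeval : ∀ i (m : ℤ), (Q i).eval (m : ℚ[X]) =
      ψ (Additive.ofMul (polyExpr T' (p i) m * (polyExpr T' (p i) 0)⁻¹)) := by
    intro i m
    have h0 := hP i 0
    rw [Int.cast_zero] at h0
    rw [eval_sub, eval_C, h0, hP, ← map_sub, ← ofMul_div, div_eq_mul_inv]
  have hfQ : ∀ i (m : ℤ), f ((Q i).eval (m : ℚ[X])) =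
      polyExpr T (p i) m * (polyExpr T (p i) 0)⁻¹ := by
    intro i m
    rw [hQeval, hfψ, ← hT', ← hT']
    rfl
  have hQ0 : ∀ i, Q i ≠ 0 := by
    intro i h
    refine hnontriv i ⟨polyExpr T (p i) 0, fun m => ?_⟩
    have h1 := hfQ i m
    have h2 := hfQ i 0
    rw [h, eval_zero] at h1 h2
    rw [h1, mul_inv_cancel] at h2
    exact mul_inv_eq_one.1 h2
  have hQinj : Function.Injective Q := by
    intro i j hij
    by_contra hne
    refine hdiff i j hne ⟨polyExpr T (p i) 0 * (polyExpr T (p j) 0)⁻¹, fun m => ?_⟩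
    have h1 := hfQ i m
    rw [hij, hfQ j m] at h1
    change polyExpr T (p i) m * (polyExpr T (p j) m)⁻¹ = _
    rw [← div_eq_mul_inv, ← div_eq_mul_inv, div_eq_div_iff_mul_eq_mul] at h1 ⊢
    rw [mul_comm (polyExpr T (p i) 0), h1]
  let A : Finset ℚ[X][X] := insert 0 (Finset.univ.image Q)
  let W : ℚ[X][X] → Set X := fun F =>
    if F = 0 then U
    else if h : ∃ i, Q i = F then {x | polyExpr T (p h.choose) 0 • x ∈ V h.choose} else Set.univ
  have hWQ : ∀ i, W (Q i) = {x | polyExpr T (p i) 0 • x ∈ V i} := by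
    intro i
    have hex : ∃ j, Q j = Q i := ⟨i, rfl⟩
    have hc : hex.choose = i := hQinj hex.choose_spec
    simp only [W]
    rw [if_neg (hQ0 i), dif_pos hex, hc]
  obtain ⟨α, hα, x, hx⟩ := exists_forall_smul_mem ψ.range f hf hmix
    (fun c => isIPStar_ipSum_ne (hΓ S hS).1 c) A (by
      intro F hF
      rcases Finset.mem_insert.1 hF with rfl | hF
      · exact ⟨eval_zero, fun m => by rw [eval_zero]; exact zero_mem _⟩
      · obtain ⟨i, -, rfl⟩ := Finset.mem_image.1 hF
        exact ⟨by simp [Q], fun m => ⟨_, (hQeval i m).symm⟩⟩) W (by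
      intro F
      simp only [W]
      split_ifs with h1 h2
      · exact hU
      · exact (hV _).preimage (continuous_const_smul _)
      · exact isOpen_univ) (by
      intro F
      simp only [W]
      split_ifs with h1 h2
      · exact hUne
      · obtain ⟨y, hy⟩ := hVne h2.choose
        exact ⟨(polyExpr T (p h2.choose) 0)⁻¹ • y, by
          rw [Set.mem_ofPred_eq, smul_inv_smul]; exact hy⟩
      · exact Set.univ_nonempty) hR
  refine ⟨α, hα, x, ?_, fun i => ?_⟩
  · have h := hx 0 (Finset.mem_insert_self _ _)
    have hf0 : f 0 = 1 := by
      have := hfψ 0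
      rwa [map_zero] at this
    rw [eval_zero, hf0, one_smul] at h
    simpa only [W, if_true] using h
  · have h := hx (Q i) (Finset.mem_insert_of_mem (Finset.mem_image_of_mem _ (Finset.mem_univ i)))
    rw [hWQ, hfQ, Set.mem_ofPred_eq, smul_smul, mul_comm, inv_mul_cancel_right] at h
    exact h

end IPSystem

theorem corollary3p5 {X Γ : Type*} [MetricSpace X] [CompactSpace X]
    [CommGroup Γ] [TopologicalSpace Γ] [IsTopologicalGroup Γ] [T2Space Γ]
    [MulAction Γ X] [ContinuousSMul Γ X]
    (n : ℕ → ℤ)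
    (hΓ : ∀ T : Γ, T ≠ 1 →
      IPSystem.IsMixingAlong X n T ∧ MulAction.IsMinimal (Subgroup.zpowers T) X)
    (d k : ℕ) (hd : 1 ≤ d) (hk : 1 ≤ k)
    (T : Fin d → Γ) (p : Fin k → Fin d → ℤ → ℤ)
    (hp : ∀ i j, IPSystem.IsIntegralPolynomial (p i j))
    (g : Fin k → ℤ → Γ) (hg : ∀ i m, g i m = IPSystem.polyExpr T (p i) m)
    (hnontriv : ∀ i, IPSystem.DependsNontrivially (g i))
    (hdiff : ∀ i j, i ≠ j → IPSystem.DependsNontrivially (fun m => g i m * (g j m)⁻¹))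
    (R : Set (Finset ℕ)) (hR : IPSystem.IsIPRing R) :
    ∃ X₀ : Set X, IsGδ X₀ ∧ Dense X₀ ∧
      ∀ x ∈ X₀, Dense {y : Fin k → X | ∃ α ∈ R, y = fun i => g i (IPSystem.ipSum n α) • x} := by
  obtain rfl : g = fun i => IPSystem.polyExpr T (p i) := funext fun i => funext fun m => hg i m
  -- On a space with at most one point mixing does not exclude torsion, so this case is separate.
  rcases subsingleton_or_nontrivial X with hX | hX
  · refine ⟨Set.univ, IsGδ.univ, dense_univ, fun x _ y => ?_⟩
    obtain ⟨α, hα, -⟩ := IPSystem.isIPStar_true R hR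
    exact subset_closure ⟨α, hα, Subsingleton.elim _ _⟩
  let 𝓑 := TopologicalSpace.countableBasis (Fin k → X)
  -- The points whose tuple enters `B` for some `α ∈ R`; intersecting over a countable basis gives
  -- `X₀`.
  let O : Set (Fin k → X) → Set X := fun B =>
    ⋃ α ∈ R, (fun x => fun i => IPSystem.polyExpr T (p i) (IPSystem.ipSum n α) • x) ⁻¹' B
  have hO : ∀ B ∈ 𝓑, IsOpen (O B) := fun B hB =>
    isOpen_biUnion fun α _ => (TopologicalSpace.isOpen_of_mem_countableBasis hB).preimage
      (continuous_pi fun i => continuous_const_smul _)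
  have hOd : ∀ B ∈ 𝓑, Dense (O B) := by
    intro B hB
    rw [dense_iff_inter_open]
    intro U hU hUne
    obtain ⟨y, hy⟩ := TopologicalSpace.nonempty_of_mem_countableBasis hB
    obtain ⟨V, hV, hVB⟩ := isOpen_pi_iff'.1
      (TopologicalSpace.isOpen_of_mem_countableBasis hB) y hy
    obtain ⟨α, hα, x, hxU, hx⟩ := IPSystem.exists_mem_forall_smul_mem hΓ hk T p hp hnontriv hdiff
      hR hU hUne V (fun i => (hV i).1) (fun i => ⟨y i, (hV i).2⟩)
    exact ⟨x, hxU, Set.mem_iUnion₂.2 ⟨α, hα, hVB fun i _ => hx i⟩⟩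
  have hcount : 𝓑.Countable := TopologicalSpace.countable_countableBasis _
  refine ⟨⋂ B ∈ 𝓑, O B, IsGδ.biInter_of_isOpen hcount hO,
    dense_biInter_of_isOpen hO hcount hOd, fun x hx => ?_⟩
  rw [(TopologicalSpace.isBasis_countableBasis (Fin k → X)).dense_iff]
  intro B hB _
  obtain ⟨α, hα, hxB⟩ := Set.mem_iUnion₂.1 (Set.mem_iInter₂.1 hx B hB)
  exact ⟨_, hxB, α, hα, rfl⟩
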